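/- All spaces are topological spaces, all maps are continuous, $I=[0,1]$. For $\alpha:A\to C$, $\beta:B\to C$ the join $A*_CB\to C$ is the homotopy pushout of the homotopy pullback of $\alpha,\beta$ (the double mapping cylinder of $A\leftarrow P\to B$, where $P=\{(a,\gamma,b):\gamma\in C^I,\ \gamma(0)=\alpha(a),\ \gamma(1)=\beta(b)\}$, mapped to $C$ by $(a,\gamma,b,t)\mapsto\gamma(t)$). For $f:Y\to X$ put $*^0_XY=Y$, $j^0_f=f$, $\iota_0=\mathrm{id}$; let $j^{n}_f:*^n_XY\to X$ be the join of $j^{n-1}_f$ and $f$, and $\iota_n:Y\to *^n_XY$ the composite of $\iota_{n-1}$ with the inclusion $*^{n-1}_XY\to *^n_XY$. Let $\mathrm{secat}(f)\in\mathbb N\cup\{\infty\}$ be the least $n$ such that $j^n_f$ has a homotopy section, and $\mathrm{relcat}(f)$ the least $n$ such that $j^n_f$ has a homotopy section $\sigma$ with $\sigma f\simeq\iota_n$. For a space $X$ let $\Delta:X\to X\times X$ be the diagonal, $\pi:X^I\to X\times X$, $\pi(\alpha)=(\alpha(0),\alpha(1))$, and $s_0:X\to X^I$ the map sending a point to the constant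 path. Put $\mathrm{TC}(X)=\mathrm{secat}(\pi)$. Let $\mathrm{TC}^M(X)$ be the least $n$ (or $\infty$) such that $j^n_\pi$ has a strict section $\sigma$ with $\sigma\Delta=\iota_ns_0$; here $*^n_{X\times X}X^I$ is formed with the explicit join of fibrations $A\amalg(A\times_CB\times[0,1])\amalg B/\sim$, $(a,b,0)\sim a$, $(a,b,1)\sim b$, with the quotient topology. \textbf{D-EH conjecture.} If a map $f:Y\to X$ has a homotopy retraction, then $\mathrm{secat}(f)=\mathrm{relcat}(f)$. \textbf{I-S conjecture.} If $X$ is (the geometric realization of) a locally finite simplicial complex, then $\mathrm{TC}(X)=\mathrm{TC}^M(X)$. \textbf{Corollary.} The D-EH conjecture implies the I-S conjecture. Moreover, if $X$ is any locally equiconnected space (i.e. $\Delta$ is a closed cofibration), then $\Delta$ has a homotopy retraction, and if the equality $\mathrm{secat}(\Delta)=\mathrm{relcat}(\Delta)$ predicted by the D-EH conjecture holds for this one map $\Delta$, then $\mathrm{TC}(X)=\mathrm{TC}^M(X)$. -/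

import Mathlib

open scoped unitInterval

universe u

namespace SecCat

/-! ### Double mapping cylinders (the standard homotopy pushout) -/

section Cylinder

variable {P A B C : Type u} [TopologicalSpace P] [TopologicalSpace A] [TopologicalSpace B]
  [TopologicalSpace C]

/-- The identifications `(p, 0) ∼ u p` and `(p, 1) ∼ v p` on `A ⨿ (P × [0,1]) ⨿ B`. -/
inductive CylRel (u : C(P, A)) (v : C(P, B)) : A ⊕ (P × I) ⊕ B → A ⊕ (P × I) ⊕ B → Prop
  | left (p : P) : CylRel u v (Sum.inr (Sum.inl (p, 0))) (Sum.inl (u p))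
  | right (p : P) : CylRel u v (Sum.inr (Sum.inl (p, 1))) (Sum.inr (Sum.inr (v p)))

/-- The double mapping cylinder `A ⨿ (P × [0,1]) ⨿ B / ∼` of `A ← P → B`, with the quotient
topology. -/
def Cylinder (u : C(P, A)) (v : C(P, B)) : Type u := Quot (CylRel u v)

instance (u : C(P, A)) (v : C(P, B)) : TopologicalSpace (Cylinder u v) :=
  inferInstanceAs (TopologicalSpace (Quot (CylRel u v)))

/-- The inclusion of `A` in the double mapping cylinder of `A ← P → B`. -/
def Cylinder.inl (u : C(P, A)) (v : C(P, B)) : C(A, Cylinder u v) where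
  toFun a := Quot.mk _ (Sum.inl a)
  continuous_toFun := continuous_quot_mk.comp continuous_inl

/-- The map out of the double mapping cylinder given by `a` on `A`, `h` on `P × [0,1]` and
`b` on `B`. -/
def Cylinder.desc (u : C(P, A)) (v : C(P, B)) (a : C(A, C)) (h : C(P × I, C)) (b : C(B, C))
    (h0 : ∀ p, h (p, 0) = a (u p)) (h1 : ∀ p, h (p, 1) = b (v p)) : C(Cylinder u v, C) where
  toFun := Quot.lift (Sum.elim a (Sum.elim h b)) (by
    rintro _ _ (p | p)
    · exact h0 p
    · exact h1 p)
  continuous_toFun := continuous_quot_lift _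
    (a.continuous.sumElim (h.continuous.sumElim b.continuous))

end Cylinder

/-! ### The join of two maps and the fibrewise join -/

section Join

variable {A B C : Type u} [TopologicalSpace A] [TopologicalSpace B] [TopologicalSpace C]

/-- The standard homotopy pullback of `α : A → C` and `β : B → C`: triples `(a, γ, b)` where `γ`
is a path in `C` from `α a` to `β b`. -/
def HPullback (α : C(A, C)) (β : C(B, C)) : Type u :=
  {p : A × C(I, C) × B // p.2.1 0 = α p.1 ∧ p.2.1 1 = β p.2.2}

instance (α : C(A, C)) (β : C(B, C)) : TopologicalSpace (HPullback α β) :=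
  inferInstanceAs (TopologicalSpace
    {p : A × C(I, C) × B // p.2.1 0 = α p.1 ∧ p.2.1 1 = β p.2.2})

/-- The projection of the homotopy pullback to `A`. -/
def HPullback.fst (α : C(A, C)) (β : C(B, C)) : C(HPullback α β, A) where
  toFun p := p.1.1
  continuous_toFun := continuous_fst.comp continuous_subtype_val

/-- The projection of the homotopy pullback to `B`. -/
def HPullback.snd (α : C(A, C)) (β : C(B, C)) : C(HPullback α β, B) where
  toFun p := p.1.2.2
  continuous_toFun := (continuous_snd.comp continuous_snd).comp continuous_subtype_val

/-- The evaluation `((a, γ, b), t) ↦ γ t`. -/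
def HPullback.eval (α : C(A, C)) (β : C(B, C)) : C(HPullback α β × I, C) where
  toFun q := q.1.1.2.1 q.2
  continuous_toFun := by
    have h : Continuous fun q : HPullback α β × I => (q.1.1.2.1, q.2) :=
      (((continuous_fst.comp continuous_snd).comp continuous_subtype_val).comp
        continuous_fst).prodMk continuous_snd
    exact ContinuousEval.continuous_eval.comp h

/-- The space `A *_C B`: the homotopy pushout of the homotopy pullback of `α` and `β`. -/
abbrev HJoin (α : C(A, C)) (β : C(B, C)) : Type u :=
  Cylinder (HPullback.fst α β) (HPullback.snd α β)

/-- The join map `A *_C B → C`. -/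
def HJoin.map (α : C(A, C)) (β : C(B, C)) : C(HJoin α β, C) :=
  Cylinder.desc _ _ α (HPullback.eval α β) β (fun p => p.2.1) (fun p => p.2.2)

/-- The strict pullback `A ×_C B`. -/
def Pullback (α : C(A, C)) (β : C(B, C)) : Type u := {p : A × B // α p.1 = β p.2}

instance (α : C(A, C)) (β : C(B, C)) : TopologicalSpace (Pullback α β) :=
  inferInstanceAs (TopologicalSpace {p : A × B // α p.1 = β p.2})

/-- The projection `A ×_C B → A`. -/
def Pullback.fst (α : C(A, C)) (β : C(B, C)) : C(Pullback α β, A) where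
  toFun p := p.1.1
  continuous_toFun := continuous_fst.comp continuous_subtype_val

/-- The projection `A ×_C B → B`. -/
def Pullback.snd (α : C(A, C)) (β : C(B, C)) : C(Pullback α β, B) where
  toFun p := p.1.2
  continuous_toFun := continuous_snd.comp continuous_subtype_val

/-- The explicit join of two fibrations, `A ⨿ (A ×_C B × [0,1]) ⨿ B / ∼` with
`(a, b, 0) ∼ a` and `(a, b, 1) ∼ b`. -/
abbrev FJoin (α : C(A, C)) (β : C(B, C)) : Type u :=
  Cylinder (Pullback.fst α β) (Pullback.snd α β)

/-- The map `FJoin α β → C`, `⟨a, b, t⟩ ↦ α a = β b`. -/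
def FJoin.map (α : C(A, C)) (β : C(B, C)) : C(FJoin α β, C) :=
  Cylinder.desc _ _ α ((α.comp (Pullback.fst α β)).comp ContinuousMap.fst) β
    (fun _ => rfl) (fun p => p.2)

end Join

/-! ### Iterated joins, sectional category and relative category -/

/-- A space together with a map to `X`. -/
structure Over (X : Type u) [TopologicalSpace X] where
  /-- the total space -/
  carrier : Type u
  /-- its topology -/
  [top : TopologicalSpace carrier]
  /-- the map to `X` -/
  proj : C(carrier, X)

attribute [instance] Over.top

section Invariants

variable {X Y : Type u} [TopologicalSpace X] [TopologicalSpace Y]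

/-- The iterated join `j^n_f : *^n_X Y → X` of `n + 1` copies of `f`. -/
def iterJoin (f : C(Y, X)) : ℕ → Over X
  | 0 => ⟨Y, f⟩
  | n + 1 => ⟨HJoin (iterJoin f n).proj f, HJoin.map (iterJoin f n).proj f⟩

/-- The map `ι_n : Y → *^n_X Y`. -/
def iterIncl (f : C(Y, X)) : (n : ℕ) → C(Y, (iterJoin f n).carrier)
  | 0 => ContinuousMap.id Y
  | n + 1 => (Cylinder.inl (HPullback.fst (iterJoin f n).proj f)
      (HPullback.snd (iterJoin f n).proj f)).comp (iterIncl f n)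

/-- The iterated join of `n + 1` copies of a fibration `f`, built from the explicit join of
fibrations. -/
def iterFJoin (f : C(Y, X)) : ℕ → Over X
  | 0 => ⟨Y, f⟩
  | n + 1 => ⟨FJoin (iterFJoin f n).proj f, FJoin.map (iterFJoin f n).proj f⟩

/-- The map `ι_n` from `Y` to the explicit iterated join; here `j^n_f ∘ ι_n = f` strictly. -/
def iterFIncl (f : C(Y, X)) : (n : ℕ) → C(Y, (iterFJoin f n).carrier)
  | 0 => ContinuousMap.id Y
  | n + 1 => (Cylinder.inl (Pullback.fst (iterFJoin f n).proj f)
      (Pullback.snd (iterFJoin f n).proj f)).comp (iterFIncl f n)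

/-- `s` is a homotopy section of `j`, i.e. `j ∘ s ≃ id`. -/
def IsHomotopySection {E : Type u} [TopologicalSpace E] (j : C(E, X)) (s : C(X, E)) : Prop :=
  (j.comp s).Homotopic (ContinuousMap.id X)

/-- `f` admits a homotopy retraction `r`, i.e. `r ∘ f ≃ id`. -/
def HasHomotopyRetraction (f : C(Y, X)) : Prop :=
  ∃ r : C(X, Y), (r.comp f).Homotopic (ContinuousMap.id Y)

/-- The sectional category: the least `n` (or `∞`) such that `j^n_f` has a homotopy section. -/
noncomputable def secat (f : C(Y, X)) : ℕ∞ :=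
  ⨅ (n : ℕ) (_ : ∃ s : C(X, (iterJoin f n).carrier), IsHomotopySection (iterJoin f n).proj s),
    (n : ℕ∞)

/-- The relative category: the least `n` (or `∞`) such that `j^n_f` has a homotopy section `s`
with `s ∘ f ≃ ι_n`. -/
noncomputable def relcat (f : C(Y, X)) : ℕ∞ :=
  ⨅ (n : ℕ) (_ : ∃ s : C(X, (iterJoin f n).carrier), IsHomotopySection (iterJoin f n).proj s ∧
    (s.comp f).Homotopic (iterIncl f n)), (n : ℕ∞)

end Invariants

/-! ### Topological complexity and monoidal topological complexity -/

section TC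

variable (X : Type u) [TopologicalSpace X]

/-- The diagonal `Δ : X → X × X`. -/
def diag : C(X, X × X) := (ContinuousMap.id X).prodMk (ContinuousMap.id X)

/-- The path fibration `π : X^I → X × X`, `α ↦ (α 0, α 1)`. -/
def pathFib : C(C(I, X), X × X) where
  toFun α := (α 0, α 1)
  continuous_toFun :=
    (ContinuousEvalConst.continuous_eval_const 0).prodMk
      (ContinuousEvalConst.continuous_eval_const 1)

/-- The map `s₀ : X → X^I` sending a point to the constant path. -/
def constPath : C(X, C(I, X)) := ContinuousMap.const'

/-- Farber's (reduced) topological complexity `secat π`. -/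
noncomputable def TC : ℕ∞ := secat (pathFib X)

/-- The monoidal topological complexity: the least `n` (or `∞`) such that
`j^n_π : *^n_{X × X} X^I → X × X` (explicit join of fibrations) has a strict section `s` with
`s ∘ Δ = ι_n ∘ s₀`. -/
noncomputable def TCM : ℕ∞ :=
  ⨅ (n : ℕ) (_ : ∃ s : C(X × X, (iterFJoin (pathFib X) n).carrier),
    (iterFJoin (pathFib X) n).proj.comp s = ContinuousMap.id (X × X) ∧
    s.comp (diag X) = (iterFIncl (pathFib X) n).comp (constPath X)), (n : ℕ∞)

end TC

/-- A closed cofibration: a closed embedding with the homotopy extension property. -/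
def IsClosedCofibration {A X : Type u} [TopologicalSpace A] [TopologicalSpace X]
    (i : C(A, X)) : Prop :=
  Topology.IsClosedEmbedding i ∧
    ∀ (Z : Type u) [TopologicalSpace Z] (g : C(X, Z)) (H : C(A × I, Z)),
      (∀ a, H (a, 0) = g (i a)) →
        ∃ K : C(X × I, Z), (∀ x, K (x, 0) = g x) ∧ ∀ a t, K (i a, t) = H (a, t)

/-- `X` is locally equiconnected: the diagonal `X → X × X` is a closed cofibration. -/
def LocallyEquiconnected (X : Type u) [TopologicalSpace X] : Prop :=
  IsClosedCofibration (diag X)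

/-! ### Locally finite simplicial complexes -/

section Complexes

variable {V : Type u}

/-- The closed simplex with vertex set `s`, in barycentric coordinates. -/
def closedSimplex (s : Finset V) : Set (V → ℝ) :=
  {x | (∀ v, 0 ≤ x v) ∧ (∀ v ∉ s, x v = 0) ∧ ∑ v ∈ s, x v = 1}

/-- The geometric realization of a simplicial complex. -/
def Realization (K : PreAbstractSimplicialComplex V) : Type u :=
  {x : V → ℝ // ∃ s ∈ K.faces, x ∈ closedSimplex s}

/-- The inclusion of a closed simplex in the geometric realization. -/
def simplexIncl (K : PreAbstractSimplicialComplex V) (s : K.faces) (x : closedSimplex s.1) :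
    Realization K :=
  ⟨x.1, s.1, s.2, x.2⟩

/-- The weak topology: a set is open if and only if its trace on every closed simplex is open
(closed simplices have their Euclidean topology). -/
instance (K : PreAbstractSimplicialComplex V) : TopologicalSpace (Realization K) :=
  ⨆ s : K.faces, TopologicalSpace.coinduced (simplexIncl K s) inferInstance

/-- Every vertex belongs to only finitely many simplices. -/
def IsLocallyFinite (K : PreAbstractSimplicialComplex V) : Prop :=
  ∀ v : V, {s ∈ K.faces | v ∈ s}.Finite

end Complexes

/-! ### The two conjectures -/

/-- The Doeraene–El Haouari conjecture: `secat f = relcat f` for every map with a homotopy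
retraction. -/
def DEHConjecture : Prop :=
  ∀ (X Y : Type u) [TopologicalSpace X] [TopologicalSpace Y] (f : C(Y, X)),
    HasHomotopyRetraction f → secat f = relcat f

/-- The Iwase–Sakai conjecture: `TC = TC^M` for every locally finite simplicial complex. -/
def ISConjecture : Prop :=
  ∀ (V : Type u) (K : PreAbstractSimplicialComplex V), IsLocallyFinite K →
    TC (Realization K) = TCM (Realization K)

end SecCat

namespace SecCat

section Realization

variable {V : Type u} {K : PreAbstractSimplicialComplex V}

theorem continuous_simplexIncl (s : K.faces) : Continuous (simplexIncl K s) := by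
  rw [continuous_iff_coinduced_le]
  exact le_iSup (fun s : K.faces => TopologicalSpace.coinduced (simplexIncl K s) inferInstance) s

theorem Realization.continuous_coord (v : V) : Continuous fun x : Realization K => x.1 v := by
  refine continuous_iSup_dom.2 fun s => continuous_coinduced_dom.2 ?_
  exact (continuous_apply v).comp continuous_subtype_val

theorem finsum_le_finsum_of_le {c d : V → ℝ} (hc : (Function.support c).Finite)
    (hd : (Function.support d).Finite) (h : ∀ v, c v ≤ d v) : ∑ᶠ v, c v ≤ ∑ᶠ v, d v := by
  rw [← sub_nonneg, ← finsum_sub_distrib hd hc]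
  exact finsum_nonneg fun v => sub_nonneg.2 (h v)

theorem Realization.nonneg (x : Realization K) (v : V) : 0 ≤ x.1 v := by
  obtain ⟨s, -, h⟩ := x.2
  exact h.1 v

theorem mem_of_mem_closedSimplex {s : Finset V} {x : V → ℝ} (hx : x ∈ closedSimplex s) {v : V}
    (hv : x v ≠ 0) : v ∈ s :=
  by_contra fun h => hv (hx.2.1 v h)

theorem finsum_eq_one_of_mem_closedSimplex {s : Finset V} {x : V → ℝ}
    (hx : x ∈ closedSimplex s) : ∑ᶠ v, x v = 1 := by
  rw [finsum_eq_sum_of_support_subset x (s := s)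
    (fun v hv => mem_of_mem_closedSimplex hx hv)]
  exact hx.2.2

theorem Realization.finsum_eq_one (x : Realization K) : ∑ᶠ v, x.1 v = 1 := by
  obtain ⟨s, -, h⟩ := x.2
  exact finsum_eq_one_of_mem_closedSimplex h

theorem Realization.support_finite (x : Realization K) : (Function.support x.1).Finite := by
  obtain ⟨s, -, h⟩ := x.2
  exact s.finite_toSet.subset fun v hv => mem_of_mem_closedSimplex h hv

theorem Realization.exists_pos (x : Realization K) : ∃ v, 0 < x.1 v := by
  by_contra! h
  have : ∑ᶠ v, x.1 v = 0 := finsum_eq_zero_of_forall_eq_zero fun v => le_antisymm (h v) (x.nonneg v)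
  rw [x.finsum_eq_one] at this
  exact one_ne_zero this

theorem isClosed_closedSimplex (s : Finset V) : IsClosed (closedSimplex s) := by
  have : closedSimplex s = (⋂ v, {x : V → ℝ | 0 ≤ x v}) ∩ ((⋂ v, ⋂ (_ : v ∉ s), {x | x v = 0}) ∩
      {x | ∑ v ∈ s, x v = 1}) := by
    ext x
    simp [closedSimplex]
  rw [this]
  refine (isClosed_iInter fun v => isClosed_le continuous_const (continuous_apply v)).inter
    ((isClosed_iInter fun v => isClosed_iInter fun _ =>
      isClosed_eq (continuous_apply v) continuous_const).inter
      (isClosed_eq (continuous_finsetSum _ fun v _ => continuous_apply v) continuous_const))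

/-- A map to the realization of a locally finite complex is continuous as soon as its barycentric
coordinates are. -/
theorem Realization.continuous_of_coord (hK : IsLocallyFinite K) {T : Type*} [TopologicalSpace T]
    {f : T → Realization K} (hf : ∀ v, Continuous fun w => (f w).1 v) : Continuous f := by
  have hf' : Continuous fun w => (f w).1 := continuous_pi hf
  refine LocallyFinite.continuous (f := fun s : K.faces => {w | (f w).1 ∈ closedSimplex s.1})
    (fun w => ?_) ?_ (fun s => (isClosed_closedSimplex s.1).preimage hf') fun s => ?_
  · obtain ⟨v, hv⟩ := (f w).exists_pos
    refine ⟨{w | 0 < (f w).1 v}, (isOpen_lt continuous_const (hf v)).mem_nhds hv, ?_⟩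
    refine Set.Finite.of_finite_image (f := Subtype.val) ((hK v).subset ?_)
      Subtype.val_injective.injOn
    rintro _ ⟨s, ⟨w', h1, h2⟩, rfl⟩
    exact ⟨s.2, mem_of_mem_closedSimplex h1 h2.ne'⟩
  · refine Set.eq_univ_of_forall fun w => ?_
    obtain ⟨s, hs, h⟩ := (f w).2
    exact Set.mem_iUnion.2 ⟨⟨s, hs⟩, h⟩
  · rw [continuousOn_iff_continuous_domRestrict]
    exact (continuous_simplexIncl s).comp
      ((hf'.comp continuous_subtype_val).subtype_mk fun w => w.2)

theorem Realization.locallyFinite_support (hK : IsLocallyFinite K) :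
    LocallyFinite fun v => Function.support fun x : Realization K => x.1 v := by
  intro x
  obtain ⟨v, hv⟩ := x.exists_pos
  refine ⟨{y | 0 < y.1 v}, (isOpen_lt continuous_const (continuous_coord v)).mem_nhds hv, ?_⟩
  refine ((hK v).biUnion fun s _ => s.finite_toSet).subset ?_
  rintro v' ⟨y, h1, h2⟩
  obtain ⟨s, hs, h⟩ := y.2
  exact Set.mem_biUnion (x := s) ⟨hs, mem_of_mem_closedSimplex h (ne_of_gt h2)⟩
    (mem_of_mem_closedSimplex h h1)

/-- Rescaling nonnegative weights supported in the carrier of a point of the realization. -/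
noncomputable def Realization.normalize (x : Realization K) (c : V → ℝ) (h0 : ∀ v, 0 ≤ c v)
    (h1 : ∀ v, c v ≤ x.1 v) (hc : ∑ᶠ v, c v ≠ 0) : Realization K :=
  ⟨fun v => c v / ∑ᶠ v, c v, by
    obtain ⟨s, hs, h⟩ := x.2
    have hz : ∀ v ∉ s, c v = 0 := fun v hv => le_antisymm ((h1 v).trans (h.2.1 v hv).le) (h0 v)
    refine ⟨s, hs, fun v => div_nonneg (h0 v) (finsum_nonneg h0), fun v hv => ?_, ?_⟩
    · simp only [hz v hv, zero_div]
    · rw [← Finset.sum_div, ← finsum_eq_sum_of_support_subset c (s := s), div_self hc]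
      exact fun v hv => by_contra fun h => hv (hz v h)⟩

theorem Realization.normalize_self {x : Realization K} {c : V → ℝ} {h0 h1 hc}
    {y : Realization K} (h : c = y.1) : x.normalize c h0 h1 hc = y := by
  subst h
  refine Subtype.ext (funext fun v => ?_)
  simp [normalize, y.finsum_eq_one]

section Continuity

variable {T : Type*} [TopologicalSpace T] {x : T → Realization K} {c : T → V → ℝ}

theorem Realization.continuous_finsum_of_le (hK : IsLocallyFinite K) (hx : Continuous x)
    (hc : ∀ v, Continuous fun w => c w v) (h0 : ∀ w v, 0 ≤ c w v)
    (h1 : ∀ w v, c w v ≤ (x w).1 v) : Continuous fun w => ∑ᶠ v, c w v := by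
  refine continuous_finsum hc (((locallyFinite_support hK).preimage_continuous hx).subset ?_)
  intro v w hw h
  exact hw (le_antisymm ((h1 w v).trans h.le) (h0 w v))

theorem Realization.continuous_normalize (hK : IsLocallyFinite K) (hx : Continuous x)
    (hc : ∀ v, Continuous fun w => c w v) (h0 : ∀ w v, 0 ≤ c w v)
    (h1 : ∀ w v, c w v ≤ (x w).1 v) (hs : ∀ w, ∑ᶠ v, c w v ≠ 0) :
    Continuous fun w => (x w).normalize (c w) (h0 w) (h1 w) (hs w) :=
  continuous_of_coord hK fun v => (hc v).div (continuous_finsum_of_le hK hx hc h0 h1) hs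

end Continuity

/-- The total mass of the coordinatewise minimum of two points. -/
noncomputable def Realization.overlap (x y : Realization K) : ℝ := ∑ᶠ v, min (x.1 v) (y.1 v)

/-- The coordinates of `x`, lowered by at most `t` towards the coordinates of `y`. -/
noncomputable def Realization.lower (x y : Realization K) (t : ℝ) (v : V) : ℝ :=
  x.1 v - min t (max (x.1 v - y.1 v) 0)

namespace Realization

variable (x y : Realization K)

theorem overlap_comm : x.overlap y = y.overlap x := by simp only [overlap, min_comm]

theorem overlap_self : x.overlap x = 1 := by simp [overlap, x.finsum_eq_one]

theorem lower_zero : x.lower y 0 = x.1 := by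
  funext v
  simp [lower]

theorem min_le_lower (t : ℝ) (v : V) : min (x.1 v) (y.1 v) ≤ x.lower y t v := by
  rw [lower]
  have : min t (max (x.1 v - y.1 v) 0) ≤ max (x.1 v - y.1 v) 0 := min_le_right _ _
  rcases le_total (x.1 v) (y.1 v) with h | h
  · rw [max_eq_right (by linarith)] at this ⊢
    rw [min_eq_left h]; linarith
  · rw [max_eq_left (by linarith)] at this ⊢
    rw [min_eq_right h]; linarith

theorem lower_nonneg (t : ℝ) (v : V) : 0 ≤ x.lower y t v :=
  (le_min (x.nonneg v) (y.nonneg v)).trans (min_le_lower x y t v)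

theorem lower_le {t : ℝ} (ht : 0 ≤ t) (v : V) : x.lower y t v ≤ x.1 v :=
  sub_le_self _ (le_min ht (le_max_right _ _))

theorem finite_support_of_le {c : V → ℝ} (h0 : ∀ v, 0 ≤ c v) (h1 : ∀ v, c v ≤ x.1 v) :
    (Function.support c).Finite :=
  x.support_finite.subset fun v hv h => hv (le_antisymm ((h1 v).trans h.le) (h0 v))

theorem overlap_le_one : x.overlap y ≤ 1 := by
  rw [← x.finsum_eq_one]
  exact finsum_le_finsum_of_le (x.finite_support_of_le (fun v => le_min (x.nonneg v) (y.nonneg v))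
    fun v => min_le_left _ _) x.support_finite fun v => min_le_left _ _

theorem overlap_le_lower {t : ℝ} (ht : 0 ≤ t) : x.overlap y ≤ ∑ᶠ v, x.lower y t v :=
  finsum_le_finsum_of_le (x.finite_support_of_le (fun v => le_min (x.nonneg v) (y.nonneg v))
    fun _ => min_le_left _ _) (x.finite_support_of_le (lower_nonneg x y t) (lower_le x y ht))
    (min_le_lower x y t)

theorem sub_min_le (v : V) : x.1 v - min (x.1 v) (y.1 v) ≤ 1 - x.overlap y := by
  rw [← x.finsum_eq_one, overlap, ← finsum_sub_distrib x.support_finite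
    (x.finite_support_of_le (fun v => le_min (x.nonneg v) (y.nonneg v)) fun v => min_le_left _ _)]
  refine single_le_finsum (f := fun v => x.1 v - min (x.1 v) (y.1 v)) v ?_
    fun v => sub_nonneg.2 (min_le_left _ _)
  exact x.finite_support_of_le (fun v => sub_nonneg.2 (min_le_left _ _))
    fun v => sub_le_self _ (le_min (x.nonneg v) (y.nonneg v))

theorem lower_of_le {t : ℝ} (ht : 1 - x.overlap y ≤ t) :
    x.lower y t = fun v => min (x.1 v) (y.1 v) := by
  funext v
  have h := (sub_min_le x y v).trans ht
  rw [lower]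
  rcases le_total (x.1 v) (y.1 v) with h' | h'
  · rw [min_eq_left h'] at h ⊢
    rw [max_eq_right (by linarith), min_eq_right (by linarith), sub_zero]
  · rw [min_eq_right h'] at h ⊢
    rw [max_eq_left (by linarith), min_eq_right h, sub_sub_cancel]

/-- How far a homotopy is pushed at `(x, y)`: zero away from the diagonal, one on it. -/
noncomputable def push : ℝ := max 0 (2 * x.overlap y - 1)

theorem push_nonneg : 0 ≤ x.push y := le_max_left _ _

theorem push_comm : x.push y = y.push x := by rw [push, push, overlap_comm]

theorem push_self : x.push x = 1 := by norm_num [push, overlap_self]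

theorem finsum_lower_ne_zero (t : I) : ∑ᶠ v, x.lower y (x.push y * t) v ≠ 0 := by
  rcases le_or_gt (x.overlap y) 0 with h | h
  · rw [push, max_eq_left (by linarith), zero_mul, lower_zero, x.finsum_eq_one]
    exact one_ne_zero
  · exact (h.trans_le (overlap_le_lower x y (mul_nonneg (push_nonneg x y) t.2.1))).ne'

/-- The partial deformation of pairs of points onto the diagonal, first component. -/
noncomputable def merge (t : I) : Realization K :=
  x.normalize (x.lower y (x.push y * t)) (lower_nonneg x y _)
    (lower_le x y (mul_nonneg (push_nonneg x y) t.2.1)) (finsum_lower_ne_zero x y t)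

theorem merge_zero : x.merge y 0 = x := normalize_self (by simp [lower_zero])

theorem merge_self (t : I) : x.merge x t = x := by
  refine normalize_self (funext fun v => ?_)
  simp [lower, push_self, t.2.1]

theorem merge_comm_of_le {t : I} (h : 1 - x.overlap y ≤ x.push y * t) :
    x.merge y t = y.merge x t := by
  have h1 := lower_of_le x y h
  have h2 := lower_of_le y x (t := y.push x * t) (by rwa [push_comm, overlap_comm])
  have : x.lower y (x.push y * t) = y.lower x (y.push x * t) := by
    rw [h1, h2]
    simp only [min_comm]
  refine Subtype.ext (funext fun v => ?_)
  simp only [merge, normalize, this]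

theorem continuous_overlap (hK : IsLocallyFinite K) :
    Continuous fun z : Realization K × Realization K => z.1.overlap z.2 :=
  continuous_finsum_of_le hK continuous_fst
    (fun v => ((continuous_coord v).comp continuous_fst).min
      ((continuous_coord v).comp continuous_snd))
    (fun z v => le_min (z.1.nonneg v) (z.2.nonneg v)) fun _ _ => min_le_left _ _

theorem continuous_push (hK : IsLocallyFinite K) :
    Continuous fun z : Realization K × Realization K => z.1.push z.2 :=
  continuous_const.max ((continuous_const.mul (continuous_overlap hK)).sub continuous_const)

theorem continuous_merge (hK : IsLocallyFinite K) :
    Continuous fun z : (Realization K × Realization K) × I => z.1.1.merge z.1.2 z.2 := by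
  refine continuous_normalize hK (continuous_fst.comp continuous_fst) (fun v => ?_) _ _ _
  have h1 : Continuous fun z : (Realization K × Realization K) × I => z.1.1.1 v :=
    (continuous_coord v).comp (continuous_fst.comp continuous_fst)
  have h2 : Continuous fun z : (Realization K × Realization K) × I => z.1.2.1 v :=
    (continuous_coord v).comp (continuous_snd.comp continuous_fst)
  have h3 : Continuous fun z : (Realization K × Realization K) × I =>
      z.1.1.push z.1.2 * (z.2 : ℝ) :=
    ((continuous_push hK).comp continuous_fst).mul (continuous_subtype_val.comp continuous_snd)
  exact h1.sub (h3.min ((h1.sub h2).max continuous_const))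

theorem t2Space : T2Space (Realization K) :=
  T2Space.of_injective_continuous (f := fun x : Realization K => x.1) Subtype.val_injective
    (continuous_pi continuous_coord)

end Realization

theorem isClosedEmbedding_diag (X : Type u) [TopologicalSpace X] [T2Space X] :
    Topology.IsClosedEmbedding (diag X) where
  toIsEmbedding := Topology.IsEmbedding.of_leftInverse (f := Prod.fst) (fun _ => rfl)
    continuous_fst (diag X).continuous
  isClosed_range := by
    have : Set.range (diag X) = Set.diagonal X := by
      ext ⟨x, y⟩
      simp [diag, eq_comm]
    rw [this]
    exact isClosed_diagonal

/-- The realization of a locally finite simplicial complex is locally equiconnected. -/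
theorem locallyEquiconnected_realization (hK : IsLocallyFinite K) :
    LocallyEquiconnected (Realization K) := by
  have := Realization.t2Space (K := K)
  refine ⟨isClosedEmbedding_diag _, fun Z _ g H hH => ?_⟩
  let s : (Realization K × Realization K) × I → ℝ := fun q => q.1.1.push q.1.2 * q.2
  let δ : (Realization K × Realization K) × I → ℝ := fun q => 1 - q.1.1.overlap q.1.2
  have hs : Continuous s := ((Realization.continuous_push hK).comp continuous_fst).mul
    (continuous_subtype_val.comp continuous_snd)
  have hδ : Continuous δ :=
    continuous_const.sub ((Realization.continuous_overlap hK).comp continuous_fst)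
  have hm := Realization.continuous_merge hK
  have hm' : Continuous fun z : (Realization K × Realization K) × I => z.1.2.merge z.1.1 z.2 :=
    hm.comp ((continuous_swap.comp continuous_fst).prodMk continuous_snd)
  let k : (Realization K × Realization K) × I → Z := fun q =>
    if s q ≤ δ q then g (q.1.1.merge q.1.2 q.2, q.1.2.merge q.1.1 q.2)
    else H (q.1.1.merge q.1.2 q.2, Set.projIcc 0 1 zero_le_one (s q - δ q))
  have hk : Continuous k := by
    refine Continuous.if_le (g.continuous.comp (hm.prodMk hm')) (H.continuous.comp
      (hm.prodMk (continuous_projIcc.comp (hs.sub hδ)))) hs hδ fun q hq => ?_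
    have h0 : Set.projIcc (0 : ℝ) 1 zero_le_one (s q - δ q) = 0 := by
      rw [hq, sub_self]
      exact Set.projIcc_left _
    rw [h0, hH, ← Realization.merge_comm_of_le q.1.1 q.1.2 hq.ge]
    rfl
  refine ⟨⟨k, hk⟩, fun z => ?_, fun x t => ?_⟩
  · have h : s (z, 0) ≤ δ (z, 0) := by
      simpa [s, δ] using Realization.overlap_le_one z.1 z.2
    simp only [ContinuousMap.coe_mk, k, if_pos h, Realization.merge_zero]
  · have h1 : s (diag _ x, t) = t := by
      change x.push x * (t : ℝ) = t
      rw [Realization.push_self, one_mul]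
    have h2 : δ (diag _ x, t) = 0 := by
      change 1 - x.overlap x = 0
      rw [Realization.overlap_self, sub_self]
    have h3 : (diag (Realization K) x).1 = x := rfl
    have h4 : (diag (Realization K) x).2 = x := rfl
    simp only [ContinuousMap.coe_mk, k, h1, h2, sub_zero, h3, h4, Realization.merge_self]
    split_ifs with h
    · have : t = 0 := le_antisymm h t.2.1
      rw [this, hH]
      rfl
    · rw [Set.projIcc_val]

end Realization

section CylinderMaps

variable {P A B T : Type u} [TopologicalSpace P] [TopologicalSpace A] [TopologicalSpace B]
  [TopologicalSpace T]

/-- The inclusion of `B` in the double mapping cylinder of `A ← P → B`. -/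
def Cylinder.inr (u : C(P, A)) (v : C(P, B)) : C(B, Cylinder u v) where
  toFun b := Quot.mk _ (Sum.inr (Sum.inr b))
  continuous_toFun := continuous_quot_mk.comp (continuous_inr.comp continuous_inr)

/-- The map from `P × [0,1]` to the double mapping cylinder of `A ← P → B`. -/
def Cylinder.mid (u : C(P, A)) (v : C(P, B)) : C(P × I, Cylinder u v) where
  toFun q := Quot.mk _ (Sum.inr (Sum.inl q))
  continuous_toFun := continuous_quot_mk.comp (continuous_inr.comp continuous_inl)

variable (u : C(P, A)) (v : C(P, B))

theorem Cylinder.mid_zero (p : P) : Cylinder.mid u v (p, 0) = Cylinder.inl u v (u p) :=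
  Quot.sound (CylRel.left p)

theorem Cylinder.mid_one (p : P) : Cylinder.mid u v (p, 1) = Cylinder.inr u v (v p) :=
  Quot.sound (CylRel.right p)

theorem Cylinder.ind {motive : Cylinder u v → Prop} (hl : ∀ a, motive (Cylinder.inl u v a))
    (hm : ∀ q, motive (Cylinder.mid u v q)) (hr : ∀ b, motive (Cylinder.inr u v b))
    (e : Cylinder u v) : motive e := by
  induction e using Quot.ind with
  | mk x =>
    rcases x with a | q | b
    · exact hl a
    · exact hm q
    · exact hr b

/-- The coordinate in `[0,1]` of a point of the double mapping cylinder. -/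
def Cylinder.height : C(Cylinder u v, I) where
  toFun := Quot.lift (Sum.elim (fun _ => 0) (Sum.elim Prod.snd fun _ => 1)) (by
    rintro _ _ (p | p) <;> rfl)
  continuous_toFun := continuous_quot_lift _
    (continuous_const.sumElim (continuous_snd.sumElim continuous_const))

theorem continuous_subtype_sum {S : Set (A ⊕ B)} (hS : IsOpen S) {F : S → T}
    (ha : Continuous fun x : {a : A // Sum.inl a ∈ S} => F ⟨Sum.inl x.1, x.2⟩)
    (hb : Continuous fun x : {b : B // Sum.inr b ∈ S} => F ⟨Sum.inr x.1, x.2⟩) :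
    Continuous F := by
  refine continuous_def.2 fun U hU => ?_
  rw [hS.isOpenEmbedding_subtypeVal.isOpen_iff_image_isOpen, isOpen_sum_iff]
  constructor
  · have h : IsOpen {a : A | Sum.inl a ∈ S} := hS.preimage continuous_inl
    convert h.isOpenEmbedding_subtypeVal.isOpenMap _ (hU.preimage ha)
    ext a
    simp
  · have h : IsOpen {b : B | Sum.inr b ∈ S} := hS.preimage continuous_inr
    convert h.isOpenEmbedding_subtypeVal.isOpenMap _ (hU.preimage hb)
    ext b
    simp

variable {u v}

open Classical in
/-- Maps out of an open subset of a double mapping cylinder. -/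
theorem Cylinder.exists_desc_of_isOpen {O : Set (Cylinder u v)} (hO : IsOpen O)
    (a : C({x : A // Cylinder.inl u v x ∈ O}, T)) (h : C({q : P × I // Cylinder.mid u v q ∈ O}, T))
    (b : C({x : B // Cylinder.inr u v x ∈ O}, T))
    (h0 : ∀ p h1 h2, h ⟨(p, 0), h1⟩ = a ⟨u p, h2⟩) (h1 : ∀ p h1 h2, h ⟨(p, 1), h1⟩ = b ⟨v p, h2⟩) :
    ∃ d : C(O, T), (∀ x hx, d ⟨Cylinder.inl u v x, hx⟩ = a ⟨x, hx⟩) ∧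
      (∀ q hq, d ⟨Cylinder.mid u v q, hq⟩ = h ⟨q, hq⟩) ∧
      ∀ x hx, d ⟨Cylinder.inr u v x, hx⟩ = b ⟨x, hx⟩ := by
  let D : Cylinder u v → Option T := Quot.lift (Sum.elim
    (fun x => if hx : Cylinder.inl u v x ∈ O then some (a ⟨x, hx⟩) else none)
    (Sum.elim (fun x => if hx : Cylinder.mid u v x ∈ O then some (h ⟨x, hx⟩) else none)
      (fun x => if hx : Cylinder.inr u v x ∈ O then some (b ⟨x, hx⟩) else none))) (by
    rintro _ _ (p | p)
    · have := Cylinder.mid_zero u v p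
      simp only [Sum.elim_inl, Sum.elim_inr]
      by_cases hp : Cylinder.mid u v (p, 0) ∈ O
      · rw [dif_pos hp, dif_pos (this ▸ hp), h0]
      · rw [dif_neg hp, dif_neg (this ▸ hp)]
    · have := Cylinder.mid_one u v p
      simp only [Sum.elim_inl, Sum.elim_inr]
      by_cases hp : Cylinder.mid u v (p, 1) ∈ O
      · rw [dif_pos hp, dif_pos (this ▸ hp), h1]
      · rw [dif_neg hp, dif_neg (this ▸ hp)])
  have hDa : ∀ x (hx : Cylinder.inl u v x ∈ O), D (Cylinder.inl u v x) = some (a ⟨x, hx⟩) :=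
    fun x hx => dif_pos hx
  have hDh : ∀ x (hx : Cylinder.mid u v x ∈ O), D (Cylinder.mid u v x) = some (h ⟨x, hx⟩) :=
    fun x hx => dif_pos hx
  have hDb : ∀ x (hx : Cylinder.inr u v x ∈ O), D (Cylinder.inr u v x) = some (b ⟨x, hx⟩) :=
    fun x hx => dif_pos hx
  have hs : ∀ e : O, ∃ t, D e.1 = some t := by
    rintro ⟨e, he⟩
    induction e using Cylinder.ind with
    | hl x => exact ⟨_, hDa x he⟩
    | hm x => exact ⟨_, hDh x he⟩
    | hr x => exact ⟨_, hDb x he⟩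
  choose d hd using hs
  have hda : ∀ x hx, d ⟨Cylinder.inl u v x, hx⟩ = a ⟨x, hx⟩ := fun x hx =>
    Option.some_injective _ ((hd _).symm.trans (hDa x hx))
  have hdh : ∀ x hx, d ⟨Cylinder.mid u v x, hx⟩ = h ⟨x, hx⟩ := fun x hx =>
    Option.some_injective _ ((hd _).symm.trans (hDh x hx))
  have hdb : ∀ x hx, d ⟨Cylinder.inr u v x, hx⟩ = b ⟨x, hx⟩ := fun x hx =>
    Option.some_injective _ ((hd _).symm.trans (hDb x hx))
  refine ⟨⟨d, ?_⟩, hda, hdh, hdb⟩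
  let mk : A ⊕ (P × I) ⊕ B → Cylinder u v := Quot.mk (CylRel u v)
  have hq : Topology.IsQuotientMap mk := isQuotientMap_quot_mk
  refine (hq.restrictPreimage_isOpen hO).continuous_iff.2 ?_
  have hS := hO.preimage hq.continuous
  refine continuous_subtype_sum hS ?_ (continuous_subtype_sum (hS.preimage continuous_inr) ?_ ?_)
  · exact a.continuous.congr fun x => (hda x.1 x.2).symm
  · exact h.continuous.congr fun x => (hdh x.1 x.2).symm
  · exact b.continuous.congr fun x => (hdb x.1 x.2).symm

/-- The self-map of `[0,1]` that stretches the middle third to the whole interval. -/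
noncomputable def stretch (t : I) : I := Set.projIcc 0 1 zero_le_one (3 * (t : ℝ) - 1)

theorem continuous_stretch : Continuous stretch :=
  continuous_projIcc.comp ((continuous_const.mul continuous_subtype_val).sub continuous_const)

theorem stretch_of_le {t : I} (h : (t : ℝ) ≤ 1 / 3) : stretch t = 0 :=
  Set.projIcc_of_le_left _ (by linarith)

theorem stretch_of_ge {t : I} (h : 2 / 3 ≤ (t : ℝ)) : stretch t = 1 :=
  Set.projIcc_of_right_le _ (by linarith)

open Classical in
/-- Maps into a double mapping cylinder from maps to its ends defined on overlapping open sets. -/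
theorem Cylinder.exists_glue {W : Type*} [TopologicalSpace W] (τ : C(W, I))
    (a : C({w // τ w < 1}, A)) (b : C({w // 0 < τ w}, B)) (m : C({w // 0 < τ w ∧ τ w < 1}, P))
    (ha : ∀ w h, u (m ⟨w, h⟩) = a ⟨w, h.2⟩) (hb : ∀ w h, v (m ⟨w, h⟩) = b ⟨w, h.1⟩) :
    ∃ l : C(W, Cylinder u v),
      (∀ w (h : τ w < 1), (τ w : ℝ) ≤ 1 / 3 → l w = Cylinder.inl u v (a ⟨w, h⟩)) ∧
      (∀ w (h : 0 < τ w), 2 / 3 ≤ (τ w : ℝ) → l w = Cylinder.inr u v (b ⟨w, h⟩)) ∧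
      ∀ w h, l w = Cylinder.mid u v (m ⟨w, h⟩, stretch (τ w)) := by
  have lt1 : ∀ {w}, (τ w : ℝ) ≤ 1 / 3 → τ w < 1 := fun {w} h => by
    rw [← Subtype.coe_lt_coe]
    exact h.trans_lt (by norm_num)
  have gt0 : ∀ {w}, 2 / 3 ≤ (τ w : ℝ) → 0 < τ w := fun {w} h => by
    rw [← Subtype.coe_lt_coe]
    exact lt_of_lt_of_le (by norm_num) h
  have mid : ∀ {w}, ¬ (τ w : ℝ) ≤ 1 / 3 → ¬ 2 / 3 ≤ (τ w : ℝ) → 0 < τ w ∧ τ w < 1 :=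
    fun {w} h h' => by
      rw [← Subtype.coe_lt_coe, ← Subtype.coe_lt_coe]
      push Not at h h'
      exact ⟨lt_trans (by norm_num) h, h'.trans (by norm_num)⟩
  let l : W → Cylinder u v := fun w =>
    if h : (τ w : ℝ) ≤ 1 / 3 then Cylinder.inl u v (a ⟨w, lt1 h⟩)
    else if h' : 2 / 3 ≤ (τ w : ℝ) then Cylinder.inr u v (b ⟨w, gt0 h'⟩)
    else Cylinder.mid u v (m ⟨w, mid h h'⟩, stretch (τ w))
  have hla : ∀ w (h : τ w < 1), (τ w : ℝ) ≤ 1 / 3 → l w = Cylinder.inl u v (a ⟨w, h⟩) :=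
    fun w h h' => dif_pos h'
  have hlb : ∀ w (h : 0 < τ w), 2 / 3 ≤ (τ w : ℝ) → l w = Cylinder.inr u v (b ⟨w, h⟩) :=
    fun w h h' => by
      have : ¬ (τ w : ℝ) ≤ 1 / 3 := fun h => absurd (h'.trans h) (by norm_num)
      simp only [l, dif_neg this, dif_pos h']
  have hlm : ∀ w h, l w = Cylinder.mid u v (m ⟨w, h⟩, stretch (τ w)) := fun w h => by
    by_cases h1 : (τ w : ℝ) ≤ 1 / 3
    · rw [hla w h.2 h1, stretch_of_le h1, Cylinder.mid_zero, ha]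
    by_cases h2 : 2 / 3 ≤ (τ w : ℝ)
    · rw [hlb w h.1 h2, stretch_of_ge h2, Cylinder.mid_one, hb]
    simp only [l, dif_neg h1, dif_neg h2]
  refine ⟨⟨l, continuous_iff_continuousAt.2 fun w => ?_⟩, hla, hlb, hlm⟩
  have hτ : Continuous fun w => (τ w : ℝ) := continuous_subtype_val.comp τ.continuous
  by_cases h1 : (τ w : ℝ) < 1 / 3
  · have hO : IsOpen {w | (τ w : ℝ) < 1 / 3} := isOpen_lt hτ continuous_const
    refine ContinuousOn.continuousAt (s := {w | (τ w : ℝ) < 1 / 3}) ?_ (hO.mem_nhds h1)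
    rw [continuousOn_iff_continuous_domRestrict]
    have : Continuous fun w : {w | (τ w : ℝ) < 1 / 3} =>
        Cylinder.inl u v (a ⟨w.1, lt1 (le_of_lt w.2)⟩) :=
      (Cylinder.inl u v).continuous.comp (a.continuous.comp
        (continuous_subtype_val.subtype_mk _))
    exact this.congr fun w => (hla w.1 _ (le_of_lt w.2)).symm
  by_cases h2 : 2 / 3 < (τ w : ℝ)
  · have hO : IsOpen {w | 2 / 3 < (τ w : ℝ)} := isOpen_lt continuous_const hτ
    refine ContinuousOn.continuousAt (s := {w | 2 / 3 < (τ w : ℝ)}) ?_ (hO.mem_nhds h2)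
    rw [continuousOn_iff_continuous_domRestrict]
    have : Continuous fun w : {w | 2 / 3 < (τ w : ℝ)} =>
        Cylinder.inr u v (b ⟨w.1, gt0 (le_of_lt w.2)⟩) :=
      (Cylinder.inr u v).continuous.comp (b.continuous.comp
        (continuous_subtype_val.subtype_mk _))
    exact this.congr fun w => (hlb w.1 _ (le_of_lt w.2)).symm
  · have hO : IsOpen {w | 0 < τ w ∧ τ w < 1} :=
      IsOpen.inter (isOpen_Ioi.preimage τ.continuous) (isOpen_Iio.preimage τ.continuous)
    have hw : 0 < τ w ∧ τ w < 1 := by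
      rw [← Subtype.coe_lt_coe, ← Subtype.coe_lt_coe]
      push Not at h1 h2
      exact ⟨lt_of_lt_of_le (by norm_num) h1, h2.trans_lt (by norm_num)⟩
    refine ContinuousOn.continuousAt (s := {w | 0 < τ w ∧ τ w < 1}) ?_ (hO.mem_nhds hw)
    rw [continuousOn_iff_continuous_domRestrict]
    have : Continuous fun w : {w | 0 < τ w ∧ τ w < 1} =>
        Cylinder.mid u v (m w, stretch (τ w.1)) :=
      (Cylinder.mid u v).continuous.comp (m.continuous.prodMk
        (continuous_stretch.comp (τ.continuous.comp continuous_subtype_val)))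
    exact this.congr fun w => (hlm w.1 w.2).symm

end CylinderMaps

section Paths

variable {C : Type*} [TopologicalSpace C]

/-- The reverse of `p`, then `q`, then `r`, parametrised by `[-1,0]`, `[0,1]` and `[1,2]`. -/
noncomputable def tri (p q r : C(I, C)) (x : ℝ) : C :=
  if x ≤ 0 then p (Set.projIcc 0 1 zero_le_one (-x)) else
    if x ≤ 1 then q (Set.projIcc 0 1 zero_le_one x) else r (Set.projIcc 0 1 zero_le_one (x - 1))

theorem continuous_tri {T : Type*} [TopologicalSpace T] {p q r : T → C(I, C)} {x : T → ℝ}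
    (hp : Continuous p) (hq : Continuous q) (hr : Continuous r) (hx : Continuous x)
    (h0 : ∀ w, p w 0 = q w 0) (h1 : ∀ w, q w 1 = r w 0) :
    Continuous fun w => tri (p w) (q w) (r w) (x w) := by
  refine Continuous.if_le (hp.eval (continuous_projIcc.comp hx.neg)) (Continuous.if_le
    (hq.eval (continuous_projIcc.comp hx))
    (hr.eval (continuous_projIcc.comp (hx.sub continuous_const))) hx continuous_const
    fun w hw => ?_) hx continuous_const fun w hw => ?_
  · simpa [hw, Set.projIcc_left, Set.projIcc_right] using h1 w
  · have : (0 : ℝ) ≤ 1 := zero_le_one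
    simp only [hw, neg_zero, if_pos this]
    simpa [Set.projIcc_left] using h0 w

theorem tri_neg (p q r : C(I, C)) (t : I) : tri p q r (-t) = p t := by
  have : -(t : ℝ) ≤ 0 := neg_nonpos.2 t.2.1
  rw [tri, if_pos this, neg_neg, Set.projIcc_val]

theorem tri_mid {p q : C(I, C)} (r : C(I, C)) (h : p 0 = q 0) (t : I) : tri p q r t = q t := by
  rw [tri]
  split_ifs with h1 h2
  · have : t = 0 := le_antisymm h1 t.2.1
    subst this
    simpa [Set.projIcc_left] using h
  · rw [Set.projIcc_val]
  · exact absurd t.2.2 h2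

theorem tri_one_add (p : C(I, C)) {q r : C(I, C)} (h : q 1 = r 0) (t : I) :
    tri p q r (1 + t) = r t := by
  have h0 := t.2.1
  rw [tri, if_neg (by linarith)]
  split_ifs with h1
  · have : t = 0 := le_antisymm (by linarith : (t : ℝ) ≤ 0) h0
    subst this
    simpa [Set.projIcc_right] using h
  · rw [add_sub_cancel_left, Set.projIcc_val]

theorem tri_two (p q r : C(I, C)) : tri p q r 2 = r 1 := by
  norm_num [tri, Set.projIcc_right]

theorem tri_const (c : C) (x : ℝ) :
    tri (ContinuousMap.const I c) (ContinuousMap.const I c) (ContinuousMap.const I c) x = c := by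
  simp [tri]

/-- The restriction of `tri p q r` to the interval from `x` to `y`, as a map on `[0,1]`. -/
noncomputable def triPath (p q r : C(I, C)) (h0 : p 0 = q 0) (h1 : q 1 = r 0) (x y : ℝ) :
    C(I, C) where
  toFun s := tri p q r (x + s * (y - x))
  continuous_toFun := continuous_tri continuous_const continuous_const continuous_const
    (by fun_prop) (fun _ => h0) fun _ => h1

theorem continuous_triPath {T : Type*} [TopologicalSpace T] {p q r : T → C(I, C)} {x y : T → ℝ}
    (hp : Continuous p) (hq : Continuous q) (hr : Continuous r) (hx : Continuous x)
    (hy : Continuous y) (h0 : ∀ w, p w 0 = q w 0) (h1 : ∀ w, q w 1 = r w 0) :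
    Continuous fun w => triPath (p w) (q w) (r w) (h0 w) (h1 w) (x w) (y w) := by
  refine ContinuousMap.continuous_of_continuous_uncurry _ ?_
  refine continuous_tri (hp.comp continuous_fst) (hq.comp continuous_fst)
    (hr.comp continuous_fst) ?_ (fun w => h0 w.1) (fun w => h1 w.1)
  exact (hx.comp continuous_fst).add ((continuous_subtype_val.comp continuous_snd).mul
    ((hy.comp continuous_fst).sub (hx.comp continuous_fst)))

theorem triPath_zero (p q r : C(I, C)) {h0 h1} (x y : ℝ) :
    triPath p q r h0 h1 x y 0 = tri p q r x := by
  simp [triPath]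

theorem triPath_one (p q r : C(I, C)) {h0 h1} (x y : ℝ) :
    triPath p q r h0 h1 x y 1 = tri p q r y := by
  simp [triPath]

theorem triPath_mid (p q r : C(I, C)) {h0 h1} : triPath p q r h0 h1 0 1 = q := by
  ext s
  have := tri_mid r h0 s
  simpa [triPath] using this

theorem triPath_const (c : C) {h0 h1} (x y : ℝ) :
    triPath (ContinuousMap.const I c) (ContinuousMap.const I c) (ContinuousMap.const I c) h0 h1 x y
      = ContinuousMap.const I c := by
  ext s
  exact tri_const c _

/-- The path `s ↦ γ (x + s (y - x))`, where `γ` is extended to `ℝ` by constants. -/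
noncomputable def subpath (γ : C(I, C)) (x y : ℝ) : C(I, C) where
  toFun s := γ (Set.projIcc 0 1 zero_le_one (x + s * (y - x)))
  continuous_toFun := γ.continuous.comp (continuous_projIcc.comp (by fun_prop))

theorem continuous_subpath {T : Type*} [TopologicalSpace T] {γ : T → C(I, C)} {x y : T → ℝ}
    (hγ : Continuous γ) (hx : Continuous x) (hy : Continuous y) :
    Continuous fun w => subpath (γ w) (x w) (y w) := by
  refine ContinuousMap.continuous_of_continuous_uncurry _ ?_
  exact (hγ.comp continuous_fst).eval (continuous_projIcc.comp
    ((hx.comp continuous_fst).add ((continuous_subtype_val.comp continuous_snd).mul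
    ((hy.comp continuous_fst).sub (hx.comp continuous_fst)))))

theorem subpath_zero (γ : C(I, C)) (x : I) (y : ℝ) : subpath γ x y 0 = γ x := by
  simp [subpath]

theorem subpath_one (γ : C(I, C)) (x : ℝ) (y : I) : subpath γ x y 1 = γ y := by
  simp [subpath]

end Paths

section JoinMaps

variable {A B C : Type u} [TopologicalSpace A] [TopologicalSpace B] [TopologicalSpace C]
  (α : C(A, C)) (β : C(B, C))

/-- The path component of a point of the homotopy pullback. -/
def HPullback.path : C(HPullback α β, C(I, C)) where
  toFun p := p.1.2.1
  continuous_toFun := (continuous_fst.comp continuous_snd).comp continuous_subtype_val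

theorem HPullback.path_zero (p : HPullback α β) :
    HPullback.path α β p 0 = α (HPullback.fst α β p) := p.2.1

theorem HPullback.path_one (p : HPullback α β) :
    HPullback.path α β p 1 = β (HPullback.snd α β p) := p.2.2

/-- The homotopy coordinate of the join. -/
def HJoin.height : C(HJoin α β, I) := Cylinder.height _ _

/-- Away from `B`, the join maps to `A`, and its points are joined to their images over `C`. -/
theorem HJoin.exists_left : ∃ d : C({e : HJoin α β | HJoin.height α β e < 1}, A × C(I, C)),
    (∀ e, (d e).2 0 = HJoin.map α β e.1 ∧ (d e).2 (HJoin.height α β e.1) = α (d e).1) ∧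
    ∀ a h, d ⟨Cylinder.inl _ _ a, h⟩ = (a, ContinuousMap.const I (α a)) := by
  have hp : Continuous fun q : HPullback α β × I => HPullback.path α β q.1 :=
    (HPullback.path α β).continuous.comp continuous_fst
  have ht : Continuous fun q : HPullback α β × I => (q.2 : ℝ) :=
    continuous_subtype_val.comp continuous_snd
  let h : C(HPullback α β × I, A × C(I, C)) :=
    ⟨fun q => (HPullback.fst α β q.1, subpath (HPullback.path α β q.1) q.2 (q.2 - 1)),
      ((HPullback.fst α β).continuous.comp continuous_fst).prodMk
        (continuous_subpath hp ht (ht.sub continuous_const))⟩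
  have hh : ∀ p, h (p, 0) =
      (HPullback.fst α β p, ContinuousMap.const I (α (HPullback.fst α β p))) := by
    intro p
    refine Prod.ext rfl ?_
    ext s
    refine Eq.trans ?_ (HPullback.path_zero α β p)
    change HPullback.path α β p (Set.projIcc 0 1 _ _) = _
    congr 1
    refine Set.projIcc_of_le_left _ ?_
    simp [s.2.1]
  have hO : IsOpen {e : HJoin α β | HJoin.height α β e < 1} :=
    isOpen_Iio.preimage (HJoin.height α β).continuous
  obtain ⟨d, h1, h2, h3⟩ := Cylinder.exists_desc_of_isOpen (T := A × C(I, C)) hO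
    ⟨fun a => (a.1, ContinuousMap.const I (α a.1)), continuous_subtype_val.prodMk
      (ContinuousMap.continuous_const'.comp (α.continuous.comp continuous_subtype_val))⟩
    (h.comp ⟨Subtype.val, continuous_subtype_val⟩)
    ⟨fun b => absurd (Set.mem_ofPred.1 b.2) (lt_irrefl (1 : I)), continuous_of_const
      fun b => absurd (Set.mem_ofPred.1 b.2) (lt_irrefl (1 : I))⟩ (fun p _ _ => hh p)
    fun p h1 _ => absurd (Set.mem_ofPred.1 h1) (lt_irrefl (1 : I))
  refine ⟨d, ?_, h1⟩
  rintro ⟨e, he⟩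
  induction e using Cylinder.ind with
  | hl a =>
    rw [h1]
    exact ⟨rfl, rfl⟩
  | hm q =>
    rw [h2]
    refine ⟨subpath_zero _ _ _, ?_⟩
    change subpath (HPullback.path α β q.1) q.2 (q.2 - 1) q.2 = _
    refine Eq.trans ?_ (HPullback.path_zero α β q.1)
    simp only [subpath, ContinuousMap.coe_mk]
    congr 1
    exact Set.projIcc_of_le_left _ (by linarith)
  | hr b => exact absurd (Set.mem_ofPred.1 he) (lt_irrefl (1 : I))

/-- Away from `A`, the join maps to `B`, and its points are joined to their images over `C`. -/
theorem HJoin.exists_right : ∃ d : C({e : HJoin α β | 0 < HJoin.height α β e}, B × C(I, C)),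
    ∀ e, (d e).2 0 = HJoin.map α β e.1 ∧ (d e).2 1 = β (d e).1 := by
  have hp : Continuous fun q : HPullback α β × I => HPullback.path α β q.1 :=
    (HPullback.path α β).continuous.comp continuous_fst
  have ht : Continuous fun q : HPullback α β × I => (q.2 : ℝ) :=
    continuous_subtype_val.comp continuous_snd
  let h : C(HPullback α β × I, B × C(I, C)) :=
    ⟨fun q => (HPullback.snd α β q.1, subpath (HPullback.path α β q.1) q.2 1),
      ((HPullback.snd α β).continuous.comp continuous_fst).prodMk
        (continuous_subpath hp ht continuous_const)⟩
  have hh : ∀ p, h (p, 1) =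
      (HPullback.snd α β p, ContinuousMap.const I (β (HPullback.snd α β p))) := by
    intro p
    refine Prod.ext rfl ?_
    ext s
    refine Eq.trans ?_ (HPullback.path_one α β p)
    change HPullback.path α β p (Set.projIcc 0 1 _ _) = _
    congr 1
    refine Set.projIcc_of_right_le _ ?_
    simp
  have hO : IsOpen {e : HJoin α β | 0 < HJoin.height α β e} :=
    isOpen_Ioi.preimage (HJoin.height α β).continuous
  obtain ⟨d, h1, h2, h3⟩ := Cylinder.exists_desc_of_isOpen (T := B × C(I, C)) hO
    ⟨fun a => absurd (Set.mem_ofPred.1 a.2) (lt_irrefl (0 : I)), continuous_of_const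
      fun a => absurd (Set.mem_ofPred.1 a.2) (lt_irrefl (0 : I))⟩
    (h.comp ⟨Subtype.val, continuous_subtype_val⟩)
    ⟨fun b => (b.1, ContinuousMap.const I (β b.1)), continuous_subtype_val.prodMk
      (ContinuousMap.continuous_const'.comp (β.continuous.comp continuous_subtype_val))⟩
    (fun p h1 _ => absurd (Set.mem_ofPred.1 h1) (lt_irrefl (0 : I))) fun p _ _ => hh p
  refine ⟨d, ?_⟩
  rintro ⟨e, he⟩
  induction e using Cylinder.ind with
  | hl a => exact absurd (Set.mem_ofPred.1 he) (lt_irrefl (0 : I))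
  | hm q =>
    rw [h2]
    exact ⟨subpath_zero _ _ _, (subpath_one _ _ 1).trans (HPullback.path_one α β q.1)⟩
  | hr a =>
    rw [h3]
    exact ⟨rfl, rfl⟩

variable {α β}

/-- A path over `C` that continues `p`, reversed from the parameter `t`, by `q`. -/
theorem exists_extend_path {W : Type*} [TopologicalSpace W] (p q : C(W, C(I, C))) (t : C(W, I))
    (h : ∀ w, p w 0 = q w 0) : ∃ r : C(W, C(I, C)), (∀ w, r w 0 = p w (t w)) ∧
      (∀ w, r w 1 = q w 1) ∧ ∀ w, t w = 0 → r w = q w := by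
  have h1 : ∀ w, q w 1 = ContinuousMap.const I (q w 1) 0 := fun _ => rfl
  refine ⟨⟨fun w => triPath (p w) (q w) (ContinuousMap.const I (q w 1)) (h w) (h1 w) (-(t w : ℝ)) 1,
    continuous_triPath p.continuous q.continuous (ContinuousMap.continuous_const'.comp
      (q.continuous.eval_const 1)) (continuous_subtype_val.comp t.continuous).neg continuous_const
      _ _⟩, fun w => ?_, fun w => ?_, fun w hw => ?_⟩
  · exact (triPath_zero (h0 := h w) (h1 := h1 w) _ _ _ _ _).trans (tri_neg _ _ _ _)
  · exact (triPath_one (h0 := h w) (h1 := h1 w) _ _ _ _ _).trans (tri_mid _ (h w) 1)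
  · simp only [ContinuousMap.coe_mk, hw, Set.Icc.coe_zero, neg_zero, triPath_mid]

/-- Lifts to the explicit join from lifts to its factors over the open parts of a join. -/
theorem FJoin.exists_lift {A' B' : Type u} [TopologicalSpace A'] [TopologicalSpace B']
    {α' : C(A', C)} {β' : C(B', C)} {W : Type u} [TopologicalSpace W] (ρ : C(W, HJoin α β))
    (G : C(W, C(I, C))) (hG : ∀ w, G w 0 = HJoin.map α β (ρ w))
    {Q : A → C(I, C) → A' → Prop}
    (hA : ∀ (W : Type u) [TopologicalSpace W] (ρ : C(W, A)) (G : C(W, C(I, C))),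
      (∀ w, G w 0 = α (ρ w)) → ∃ l : C(W, A'), (∀ w, α' (l w) = G w 1) ∧ ∀ w, Q (ρ w) (G w) (l w))
    (hB : ∀ (W : Type u) [TopologicalSpace W] (ρ : C(W, B)) (G : C(W, C(I, C))),
      (∀ w, G w 0 = β (ρ w)) → ∃ l : C(W, B'), ∀ w, β' (l w) = G w 1) :
    ∃ l : C(W, FJoin α' β'), (∀ w, FJoin.map α' β' (l w) = G w 1) ∧
      ∀ w a, ρ w = Cylinder.inl _ _ a → ∃ a', l w = Cylinder.inl _ _ a' ∧ Q a (G w) a' := by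
  let τ : C(W, I) := (HJoin.height α β).comp ρ
  obtain ⟨d0, hd0, hd0'⟩ := HJoin.exists_left α β
  obtain ⟨d1, hd1⟩ := HJoin.exists_right α β
  let e0 : C({w // τ w < 1}, A × C(I, C)) :=
    d0.comp ⟨fun w => ⟨ρ w.1, w.2⟩, (ρ.continuous.comp continuous_subtype_val).subtype_mk _⟩
  let e1 : C({w // 0 < τ w}, B × C(I, C)) :=
    d1.comp ⟨fun w => ⟨ρ w.1, w.2⟩, (ρ.continuous.comp continuous_subtype_val).subtype_mk _⟩
  obtain ⟨G0, h00, h01, h02⟩ := exists_extend_path (ContinuousMap.snd.comp e0)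
    (G.comp ⟨Subtype.val, continuous_subtype_val⟩) (τ.comp ⟨Subtype.val, continuous_subtype_val⟩)
    fun w => ((hd0 _).1.trans (hG w.1).symm)
  obtain ⟨G1, h10, h11, -⟩ := exists_extend_path (ContinuousMap.snd.comp e1)
    (G.comp ⟨Subtype.val, continuous_subtype_val⟩) (ContinuousMap.const _ 1)
    fun w => ((hd1 _).1.trans (hG w.1).symm)
  obtain ⟨l0, hl0, hQ⟩ := hA _ (ContinuousMap.fst.comp e0) G0
    fun w => (h00 w).trans (hd0 ⟨ρ w.1, w.2⟩).2
  obtain ⟨l1, hl1⟩ := hB _ (ContinuousMap.fst.comp e1) G1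
    fun w => (h10 w).trans (hd1 ⟨ρ w.1, w.2⟩).2
  have hl0' : ∀ w, α' (l0 w) = G w.1 1 := fun w => (hl0 w).trans (h01 w)
  have hl1' : ∀ w, β' (l1 w) = G w.1 1 := fun w => (hl1 w).trans (h11 w)
  let m : C({w // 0 < τ w ∧ τ w < 1}, Pullback α' β') :=
    ⟨fun w => ⟨(l0 ⟨w.1, w.2.2⟩, l1 ⟨w.1, w.2.1⟩), (hl0' _).trans (hl1' ⟨w.1, w.2.1⟩).symm⟩,
      ((l0.continuous.comp (continuous_subtype_val.subtype_mk _)).prodMk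
        (l1.continuous.comp (continuous_subtype_val.subtype_mk _))).subtype_mk _⟩
  obtain ⟨l, hla, hlb, hlm⟩ := Cylinder.exists_glue (u := Pullback.fst α' β')
    (v := Pullback.snd α' β') τ l0 l1 m (fun _ _ => rfl) fun _ _ => rfl
  refine ⟨l, fun w => ?_, fun w a hw => ?_⟩
  · by_cases h0 : 0 < τ w
    · by_cases h1 : τ w < 1
      · rw [hlm w ⟨h0, h1⟩]
        exact hl0' _
      · have : τ w = 1 := le_antisymm (τ w).2.2 (not_lt.1 h1)
        rw [hlb w h0 (by rw [this]; norm_num)]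
        exact hl1' _
    · have : τ w = 0 := le_antisymm (not_lt.1 h0) (τ w).2.1
      rw [hla w (by rw [this]; exact zero_lt_one) (by rw [this]; norm_num)]
      exact hl0' _
  · have h0 : τ w = 0 := congrArg (HJoin.height α β) hw
    have h1 : τ w < 1 := by rw [h0]; exact zero_lt_one
    refine ⟨l0 ⟨w, h1⟩, hla w h1 (by rw [h0]; norm_num), ?_⟩
    have h2 : e0 ⟨w, h1⟩ = (a, ContinuousMap.const I (α a)) := by
      rw [← hd0' a (Set.mem_ofPred.2 zero_lt_one)]
      exact congrArg d0 (Subtype.ext hw)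
    have h3 := hQ ⟨w, h1⟩
    rw [h02 ⟨w, h1⟩ h0] at h3
    have h4 : (ContinuousMap.fst.comp e0) ⟨w, h1⟩ = a := congrArg Prod.fst h2
    rwa [h4] at h3

/-- The explicit join maps to the homotopy join. -/
theorem FJoin.exists_toHJoin {A' : Type u} [TopologicalSpace A'] {α' : C(A', C)} (φ : C(A, A'))
    (hφ : ∀ a, α' (φ a) = α a) : ∃ θ : C(FJoin α β, HJoin α' β),
      (∀ e, HJoin.map α' β (θ e) = FJoin.map α β e) ∧
      ∀ a, θ (Cylinder.inl _ _ a) = Cylinder.inl _ _ (φ a) := by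
  let i : C(Pullback α β, HPullback α' β) :=
    ⟨fun p => ⟨(φ p.1.1, ContinuousMap.const I (β p.1.2), p.1.2), (hφ _ |>.trans p.2).symm, rfl⟩,
      ((φ.continuous.comp (Pullback.fst α β).continuous).prodMk
        ((ContinuousMap.continuous_const'.comp (β.continuous.comp
          (Pullback.snd α β).continuous)).prodMk (Pullback.snd α β).continuous)).subtype_mk _⟩
  refine ⟨Cylinder.desc _ _ ((Cylinder.inl _ _).comp φ)
    ((Cylinder.mid (HPullback.fst α' β) (HPullback.snd α' β)).comp
      ((i.comp ContinuousMap.fst).prodMk ContinuousMap.snd)) (Cylinder.inr _ _)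
    (fun p => Cylinder.mid_zero _ _ (i p)) (fun p => Cylinder.mid_one _ _ (i p)),
    fun e => ?_, fun _ => rfl⟩
  induction e using Cylinder.ind with
  | hl a => exact hφ a
  | hm q => exact q.1.2.symm
  | hr b => rfl

/-- Functoriality of the homotopy join with respect to maps that commute up to homotopy. -/
theorem HJoin.exists_map {A' B' : Type u} [TopologicalSpace A'] [TopologicalSpace B']
    {α' : C(A', C)} {β' : C(B', C)} (φ : C(A, A')) (h : C(A, C(I, C))) (h0 : ∀ a, h a 0 = α a)
    (h1 : ∀ a, h a 1 = α' (φ a)) (ψ : C(B, B')) (k : C(B, C(I, C))) (k0 : ∀ b, k b 0 = β b)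
    (k1 : ∀ b, k b 1 = β' (ψ b)) :
    ∃ (Φ : C(HJoin α β, HJoin α' β')) (H : C(HJoin α β, C(I, C))),
      (∀ e, H e 0 = HJoin.map α β e) ∧ ∀ e, H e 1 = HJoin.map α' β' (Φ e) := by
  let p : C(HPullback α β, C(I, C)) := h.comp (HPullback.fst α β)
  let q : C(HPullback α β, C(I, C)) := HPullback.path α β
  let r : C(HPullback α β, C(I, C)) := k.comp (HPullback.snd α β)
  have hpq : ∀ x, p x 0 = q x 0 := fun x => (h0 _).trans (HPullback.path_zero α β x).symm
  have hqr : ∀ x, q x 1 = r x 0 := fun x => (HPullback.path_one α β x).trans (k0 _).symm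
  let i : C(HPullback α β, HPullback α' β') :=
    ⟨fun x => ⟨(φ (HPullback.fst α β x), triPath (p x) (q x) (r x) (hpq x) (hqr x) (-1) 2,
        ψ (HPullback.snd α β x)),
        (triPath_zero (h0 := hpq x) (h1 := hqr x) _ _ _ _ _).trans ((tri_neg _ _ _ 1).trans (h1 _)),
        (triPath_one (h0 := hpq x) (h1 := hqr x) _ _ _ _ _).trans ((tri_two _ _ _).trans (k1 _))⟩,
      ((φ.continuous.comp (HPullback.fst α β).continuous).prodMk
        ((continuous_triPath p.continuous q.continuous r.continuous continuous_const
          continuous_const hpq hqr).prodMk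
        (ψ.continuous.comp (HPullback.snd α β).continuous))).subtype_mk _⟩
  have ht : Continuous fun x : HPullback α β × I => (x.2 : ℝ) :=
    continuous_subtype_val.comp continuous_snd
  let j : C(HPullback α β × I, C(I, C)) :=
    ⟨fun x => triPath (p x.1) (q x.1) (r x.1) (hpq x.1) (hqr x.1) x.2 (3 * x.2 - 1),
      continuous_triPath (p.continuous.comp continuous_fst) (q.continuous.comp continuous_fst)
        (r.continuous.comp continuous_fst) ht ((continuous_const.mul ht).sub continuous_const) _ _⟩
  refine ⟨Cylinder.desc _ _ ((Cylinder.inl _ _).comp φ)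
    ((Cylinder.mid (HPullback.fst α' β') (HPullback.snd α' β')).comp
      ((i.comp ContinuousMap.fst).prodMk ContinuousMap.snd)) ((Cylinder.inr _ _).comp ψ)
    (fun x => Cylinder.mid_zero _ _ (i x)) (fun x => Cylinder.mid_one _ _ (i x)),
    Cylinder.desc _ _ h j k (fun x => ?_) (fun x => ?_), fun e => ?_, fun e => ?_⟩
  · ext s
    refine Eq.trans ?_ (tri_neg (p x) (q x) (r x) s)
    simp [j, triPath]
  · ext s
    refine Eq.trans ?_ (tri_one_add (p x) (hqr x) s)
    simp only [j, triPath, ContinuousMap.coe_mk, Set.Icc.coe_one]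
    congr 1
    ring
  · induction e using Cylinder.ind with
    | hl a => exact h0 a
    | hm x =>
      exact (triPath_zero (h0 := hpq x.1) (h1 := hqr x.1) _ _ _ _ _).trans (tri_mid _ (hpq _) _)
    | hr b => exact k0 b
  · induction e using Cylinder.ind with
    | hl a => exact h1 a
    | hm x =>
      refine (triPath_one (h0 := hpq x.1) (h1 := hqr x.1) _ _ _ _ _).trans ?_
      change _ = tri (p x.1) (q x.1) (r x.1) (-1 + x.2 * (2 - -1))
      congr 1
      ring
    | hr b => exact k1 b

end JoinMaps

section Iterated

variable {X Y Y' : Type u} [TopologicalSpace X] [TopologicalSpace Y] [TopologicalSpace Y']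

theorem proj_iterIncl (f : C(Y, X)) : ∀ n y, (iterJoin f n).proj (iterIncl f n y) = f y
  | 0, _ => rfl
  | n + 1, y => proj_iterIncl f n y

theorem proj_iterFIncl (f : C(Y, X)) : ∀ n y, (iterFJoin f n).proj (iterFIncl f n y) = f y
  | 0, _ => rfl
  | n + 1, y => proj_iterFIncl f n y

theorem iterFJoin_exists_toIterJoin (f : C(Y, X)) (n : ℕ) :
    ∃ θ : C((iterFJoin f n).carrier, (iterJoin f n).carrier),
      (∀ e, (iterJoin f n).proj (θ e) = (iterFJoin f n).proj e) ∧
      ∀ y, θ (iterFIncl f n y) = iterIncl f n y := by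
  induction n with
  | zero => exact ⟨ContinuousMap.id Y, fun _ => rfl, fun _ => rfl⟩
  | succ n ih =>
    obtain ⟨φ, h1, h2⟩ := ih
    obtain ⟨θ, h3, h4⟩ := FJoin.exists_toHJoin (β := f) φ h1
    exact ⟨θ, h3, fun y => (h4 _).trans (congrArg _ (h2 y))⟩

theorem iterJoin_exists_map {f : C(Y, X)} {f' : C(Y', X)} (ψ : C(Y, Y')) (k : C(Y, C(I, X)))
    (k0 : ∀ y, k y 0 = f y) (k1 : ∀ y, k y 1 = f' (ψ y)) (n : ℕ) :
    ∃ (Φ : C((iterJoin f n).carrier, (iterJoin f' n).carrier))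
      (H : C((iterJoin f n).carrier, C(I, X))), (∀ e, H e 0 = (iterJoin f n).proj e) ∧
        ∀ e, H e 1 = (iterJoin f' n).proj (Φ e) := by
  induction n with
  | zero => exact ⟨ψ, k, k0, k1⟩
  | succ n ih =>
    obtain ⟨φ, h, h0, h1⟩ := ih
    exact HJoin.exists_map φ h h0 h1 ψ k k0 k1

/-- If paths starting in the image of `f` can be transported to points of `Y'` over their ends,
then a lift up to homotopy to the iterated join of `f` yields a strict lift to the explicit
iterated join of `f'`. -/
theorem exists_strict_lift {f : C(Y, X)} {f' : C(Y', X)}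
    (L : C({q : Y × C(I, X) // q.2 0 = f q.1}, Y')) (hL : ∀ q, f' (L q) = q.1.2 1) (n : ℕ)
    (W : Type u) [TopologicalSpace W] (ρ : C(W, (iterJoin f n).carrier)) (G : C(W, C(I, X)))
    (hG : ∀ w, G w 0 = (iterJoin f n).proj (ρ w)) :
    ∃ l : C(W, (iterFJoin f' n).carrier), (∀ w, (iterFJoin f' n).proj (l w) = G w 1) ∧
      ∀ w y, ρ w = iterIncl f n y → ∃ h, l w = iterFIncl f' n (L ⟨(y, G w), h⟩) := by
  have base : ∀ (W : Type u) [TopologicalSpace W] (ρ : C(W, Y)) (G : C(W, C(I, X)))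
      (hG : ∀ w, G w 0 = f (ρ w)), ∃ l : C(W, Y'), ∀ w, l w = L ⟨(ρ w, G w), hG w⟩ :=
    fun W _ ρ G hG => ⟨L.comp ⟨fun w => ⟨(ρ w, G w), hG w⟩,
      (ρ.continuous.prodMk G.continuous).subtype_mk _⟩, fun _ => rfl⟩
  induction n generalizing W with
  | zero =>
    obtain ⟨l, hl⟩ := base W ρ G hG
    refine ⟨l, fun w => (congrArg f' (hl w)).trans (hL _), fun w y hw => ?_⟩
    change ρ w = y at hw
    subst hw
    exact ⟨hG w, hl w⟩
  | succ n ih =>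
    obtain ⟨l, h1, h2⟩ := FJoin.exists_lift (α' := (iterFJoin f' n).proj) (β' := f') ρ G hG
      (Q := fun a γ a' => ∀ y, a = iterIncl f n y →
        ∃ h : γ 0 = f y, a' = iterFIncl f' n (L ⟨(y, γ), h⟩))
      (fun W _ ρ G hG => ih W ρ G hG) (fun W _ ρ G hG => by
        obtain ⟨l, hl⟩ := base W ρ G hG
        exact ⟨l, fun w => (congrArg f' (hl w)).trans (hL _)⟩)
    refine ⟨l, h1, fun w y hw => ?_⟩
    obtain ⟨a', ha', hQ⟩ := h2 w _ hw
    obtain ⟨h, rfl⟩ := hQ y rfl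
    exact ⟨h, ha'⟩

end Iterated

section Homotopies

variable {E Z : Type*} [TopologicalSpace E] [TopologicalSpace Z]

theorem homotopic_of_paths {f g : C(E, Z)} (H : C(E, C(I, Z))) (h0 : ∀ e, H e 0 = f e)
    (h1 : ∀ e, H e 1 = g e) : f.Homotopic g :=
  ⟨⟨⟨fun q => H q.2 q.1, (H.continuous.comp continuous_snd).eval continuous_fst⟩, h0, h1⟩⟩

theorem exists_paths_of_homotopic {f g : C(E, Z)} (h : f.Homotopic g) :
    ∃ H : C(E, C(I, Z)), (∀ e, H e 0 = f e) ∧ ∀ e, H e 1 = g e := by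
  obtain ⟨F⟩ := h
  exact ⟨(F.toContinuousMap.comp ContinuousMap.prodSwap).curry, F.apply_zero, F.apply_one⟩

end Homotopies

section PathOperations

variable {X : Type*} [TopologicalSpace X]

/-- Postcomposition of paths with a map. -/
def mapPath {Z : Type*} [TopologicalSpace Z] (f : C(X, Z)) : C(C(I, X), C(I, Z)) :=
  ⟨fun γ => f.comp γ, ContinuousMap.continuous_postcomp f⟩

/-- The reverse of the first path followed by the second. -/
noncomputable def invConcat : C({q : C(I, X) × C(I, X) // q.1 0 = q.2 0}, C(I, X)) where
  toFun q := triPath q.1.1 q.1.2 (ContinuousMap.const I (q.1.2 1)) q.2 rfl (-1) 1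
  continuous_toFun := by
    have h : Continuous fun q : {q : C(I, X) × C(I, X) // q.1 0 = q.2 0} => q.1.2 :=
      continuous_snd.comp continuous_subtype_val
    exact continuous_triPath (continuous_fst.comp continuous_subtype_val) h
      (ContinuousMap.continuous_const'.comp ((ContinuousEvalConst.continuous_eval_const 1).comp h))
      continuous_const continuous_const (fun q => q.2) fun _ => rfl

theorem invConcat_zero (q : {q : C(I, X) × C(I, X) // q.1 0 = q.2 0}) :
    invConcat q 0 = q.1.1 1 :=
  (triPath_zero (h0 := q.2) (h1 := rfl) _ _ _ _ _).trans (tri_neg _ _ _ 1)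

theorem invConcat_one (q : {q : C(I, X) × C(I, X) // q.1 0 = q.2 0}) :
    invConcat q 1 = q.1.2 1 :=
  (triPath_one (h0 := q.2) (h1 := rfl) _ _ _ _ _).trans (tri_mid _ q.2 1)

/-- The canonical contraction of the loop `ω⁻¹ ω`. -/
theorem exists_contract_invConcat {T : Type*} [TopologicalSpace T] (ω : C(T, C(I, X))) :
    ∃ h : C(T × I, C(I, X)), (∀ x, h (x, 0) = invConcat ⟨(ω x, ω x), rfl⟩) ∧
      (∀ x, h (x, 1) = ContinuousMap.const I (ω x 1)) ∧
      ∀ q, h q 0 = ω q.1 1 ∧ h q 1 = ω q.1 1 := by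
  have hc : Continuous fun q : T × I => subpath (ω q.1) q.2 1 :=
    continuous_subpath (ω.continuous.comp continuous_fst)
      (continuous_subtype_val.comp continuous_snd) continuous_const
  refine ⟨invConcat.comp ⟨fun q => ⟨(subpath (ω q.1) q.2 1, subpath (ω q.1) q.2 1), rfl⟩,
    (hc.prodMk hc).subtype_mk _⟩, fun x => ?_, fun x => ?_, fun q => ⟨?_, ?_⟩⟩
  · have : subpath (ω x) ((0 : I) : ℝ) 1 = ω x := by
      ext s
      simp [subpath]
    simp only [ContinuousMap.comp_apply, ContinuousMap.coe_mk, this]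
  · have : subpath (ω x) ((1 : I) : ℝ) 1 = ContinuousMap.const I (ω x 1) := by
      ext s
      simp [subpath]
    simp only [ContinuousMap.comp_apply, ContinuousMap.coe_mk, this]
    exact triPath_const _ (h0 := rfl) (h1 := rfl) _ _
  · exact (invConcat_zero _).trans (subpath_one _ _ 1)
  · exact (invConcat_one _).trans (subpath_one _ _ 1)

end PathOperations

section Comparison

variable (X : Type u) [TopologicalSpace X]

variable {X} in
theorem mapPath_fst_zero {α : C(I, X)} {γ : C(I, X × X)} (h : γ 0 = pathFib X α) :
    mapPath ContinuousMap.fst γ 0 = α 0 :=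
  congrArg Prod.fst h

variable {X} in
theorem mapPath_snd_zero {α : C(I, X)} {γ : C(I, X × X)} (h : γ 0 = pathFib X α) :
    α 1 = mapPath ContinuousMap.snd γ 0 :=
  (congrArg Prod.snd h).symm

/-- Transport of a path in `X` along a path of endpoints. -/
noncomputable def conjPath :
    C({q : C(I, X) × C(I, X × X) // q.2 0 = pathFib X q.1}, C(I, X)) where
  toFun q := triPath (mapPath ContinuousMap.fst q.1.2) q.1.1 (mapPath ContinuousMap.snd q.1.2)
    (mapPath_fst_zero q.2) (mapPath_snd_zero q.2) (-1) 2
  continuous_toFun := by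
    have h : Continuous fun q : {q : C(I, X) × C(I, X × X) // q.2 0 = pathFib X q.1} => q.1.2 :=
      continuous_snd.comp continuous_subtype_val
    exact continuous_triPath ((mapPath ContinuousMap.fst).continuous.comp h)
      (continuous_fst.comp continuous_subtype_val) ((mapPath ContinuousMap.snd).continuous.comp h)
      continuous_const continuous_const (fun q => mapPath_fst_zero q.2)
      fun q => mapPath_snd_zero q.2

theorem pathFib_conjPath (q : {q : C(I, X) × C(I, X × X) // q.2 0 = pathFib X q.1}) :
    pathFib X (conjPath X q) = q.1.2 1 := by
  refine Prod.ext ?_ ?_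
  · exact (triPath_zero (h0 := mapPath_fst_zero q.2) (h1 := mapPath_snd_zero q.2)
      _ _ _ _ _).trans (tri_neg (mapPath ContinuousMap.fst q.1.2) _ _ 1)
  · exact (triPath_one (h0 := mapPath_fst_zero q.2) (h1 := mapPath_snd_zero q.2)
      _ _ _ _ _).trans (tri_two _ _ (mapPath ContinuousMap.snd q.1.2))

theorem conjPath_const (x : X) (h) :
    conjPath X ⟨(constPath X x, ContinuousMap.const I (x, x)), h⟩ = constPath X x :=
  triPath_const x (h0 := rfl) (h1 := rfl) _ _

theorem hasHomotopyRetraction_diag : HasHomotopyRetraction (diag X) :=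
  ⟨ContinuousMap.fst, ContinuousMap.Homotopic.refl _⟩

theorem secat_diag_le_TC : secat (diag X) ≤ TC X := by
  refine le_iInf₂ fun n hn => iInf₂_le n ?_
  obtain ⟨s, hs⟩ := hn
  have hk : Continuous fun α : C(I, X) =>
      ((ContinuousMap.const I (α 0)).prodMk (subpath α 1 0) : C(I, X × X)) := by
    refine ContinuousMap.continuous_of_continuous_uncurry _ ?_
    exact ((ContinuousEvalConst.continuous_eval_const 0).comp continuous_fst).prodMk
      (((continuous_subpath continuous_id continuous_const continuous_const).comp
        continuous_fst).eval continuous_snd)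
  obtain ⟨Φ, H, h0, h1⟩ := iterJoin_exists_map (f := pathFib X) (f' := diag X)
    ⟨fun α => α 0, ContinuousEvalConst.continuous_eval_const 0⟩ ⟨_, hk⟩
    (fun α => Prod.ext rfl (subpath_zero α 1 0)) (fun α => Prod.ext rfl (subpath_one α 1 0)) n
  refine ⟨Φ.comp s, ContinuousMap.Homotopic.trans ?_ hs⟩
  exact (homotopic_of_paths (H.comp s) (fun z => h0 _) fun z => h1 _).symm

theorem TC_le_TCM : TC X ≤ TCM X := by
  refine le_iInf₂ fun n hn => iInf₂_le n ?_
  obtain ⟨s, hs, -⟩ := hn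
  obtain ⟨θ, hθ, -⟩ := iterFJoin_exists_toIterJoin (pathFib X) n
  have h : (iterJoin (pathFib X) n).proj.comp (θ.comp s) = ContinuousMap.id (X × X) := by
    rw [← hs]
    exact ContinuousMap.ext fun z => hθ _
  refine ⟨θ.comp s, ?_⟩
  rw [IsHomotopySection, h]

variable {X}

/-- A homotopy section whose restriction along a cofibration is homotopic to `t` can be replaced by
one whose restriction is equal to `t`. -/
theorem exists_section_eq_on {A B E : Type u} [TopologicalSpace A] [TopologicalSpace B]
    [TopologicalSpace E] {i : C(A, B)} (hi : IsClosedCofibration i) {j : C(E, B)} {s : C(B, E)}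
    {t : C(A, E)} (hs : IsHomotopySection j s) (h : (s.comp i).Homotopic t) :
    ∃ s' : C(B, E), IsHomotopySection j s' ∧ s'.comp i = t := by
  obtain ⟨H, h0, h1⟩ := exists_paths_of_homotopic h
  obtain ⟨K, hK0, hK⟩ := hi.2 E s H.uncurry h0
  refine ⟨⟨fun x => K (x, 1), by fun_prop⟩, ?_, ContinuousMap.ext fun a => (hK a 1).trans (h1 a)⟩
  refine ContinuousMap.Homotopic.trans ?_ hs
  have h0 : ∀ x, (j.comp K).curry x 0 = (j.comp s) x := fun x => congrArg j (hK0 x)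
  exact (homotopic_of_paths _ h0 fun x => rfl).symm

/-- A homotopy section of the iterated join of `π` that is vertical over the diagonal can be made
strict. -/
theorem exists_strict_section (hX : LocallyEquiconnected X) {n : ℕ}
    (l : C(X × X, (iterFJoin (pathFib X) n).carrier))
    (hl : ∀ z, (iterFJoin (pathFib X) n).proj (l z) = z) (h : C(X × I, C(I, X)))
    (h0 : ∀ x, l (x, x) = iterFIncl (pathFib X) n (h (x, 0)))
    (h1 : ∀ x, h (x, 1) = constPath X x) (hπ : ∀ q, pathFib X (h q) = (q.1, q.1)) :
    ∃ s : C(X × X, (iterFJoin (pathFib X) n).carrier),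
      (iterFJoin (pathFib X) n).proj.comp s = ContinuousMap.id (X × X) ∧
      s.comp (diag X) = (iterFIncl (pathFib X) n).comp (constPath X) := by
  obtain ⟨K, hK0, hK⟩ := hX.2 _ l ((iterFIncl (pathFib X) n).comp h) fun x => (h0 x).symm
  obtain ⟨θ, hθ, hθι⟩ := iterFJoin_exists_toIterJoin (pathFib X) n
  let R : C((X × X) × I, (X × X) × I) := ⟨fun q => (q.1, unitInterval.symm q.2), by fun_prop⟩
  let G : C(X × X, C(I, X × X)) := (((iterFJoin (pathFib X) n).proj.comp K).comp R).curry
  have hG : ∀ z t, G z t = (iterFJoin (pathFib X) n).proj (K (z, unitInterval.symm t)) :=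
    fun _ _ => rfl
  obtain ⟨s, hs, hs'⟩ := exists_strict_lift (conjPath X) (pathFib_conjPath X) n (X × X)
    (θ.comp ⟨fun z => K (z, 1), by fun_prop⟩) G fun z => by
      rw [hG, unitInterval.symm_zero]
      exact (hθ _).symm
  refine ⟨s, ContinuousMap.ext fun z => ?_, ContinuousMap.ext fun x => ?_⟩
  · refine (hs z).trans ?_
    rw [hG, unitInterval.symm_one, hK0, hl]
    rfl
  · obtain ⟨h', e⟩ := hs' (x, x) (constPath X x) (by
      refine Eq.trans (congrArg θ (hK x 1)) ((hθι _).trans ?_)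
      rw [h1])
    refine e.trans (congrArg _ ?_)
    have : G (x, x) = ContinuousMap.const I (x, x) := by
      ext1 t
      rw [hG]
      refine (congrArg _ (hK x _)).trans ((proj_iterFIncl _ _ _).trans (hπ _))
    simp only [this]
    exact conjPath_const X x _

theorem TCM_le_relcat_diag (hX : LocallyEquiconnected X) : TCM X ≤ relcat (diag X) := by
  refine le_iInf₂ fun n hn => iInf₂_le n ?_
  obtain ⟨s, hs, hsΔ⟩ := hn
  obtain ⟨s1, hs1, hs1Δ⟩ := exists_section_eq_on hX hs hsΔ
  obtain ⟨G, hG0, hG1⟩ := exists_paths_of_homotopic hs1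
  have hG0' : ∀ x, G (x, x) 0 = (x, x) := fun x => by
    refine (hG0 _).trans ((congrArg _ (DFunLike.congr_fun hs1Δ x)).trans ?_)
    exact proj_iterIncl (diag X) n x
  let M : C({q : X × C(I, X × X) // q.2 0 = diag X q.1}, C(I, X)) :=
    (conjPath X).comp ⟨fun q => ⟨(constPath X q.1.1, q.1.2), q.2⟩,
      (((constPath X).continuous.comp (continuous_fst.comp continuous_subtype_val)).prodMk
        (continuous_snd.comp continuous_subtype_val)).subtype_mk _⟩
  have hM : ∀ q, pathFib X (M q) = q.1.2 1 := fun q => pathFib_conjPath X _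
  let ω : C(X, C(I, X)) := M.comp ⟨fun x => ⟨(x, G (x, x)), hG0' x⟩,
    (continuous_id.prodMk (G.continuous.comp (diag X).continuous)).subtype_mk _⟩
  have hω : ∀ x, pathFib X (ω x) = (x, x) := fun x => (hM _).trans (hG1 _)
  have hω0 : ∀ x, ω x 0 = x := fun x => congrArg Prod.fst (hω x)
  have hω1 : ∀ x, ω x 1 = x := fun x => congrArg Prod.snd (hω x)
  have hL : ∀ q, ω (q.1.2 1).1 0 = M q 0 := fun q =>
    (hω0 _).trans (congrArg Prod.fst (hM q)).symm
  let L : C({q : X × C(I, X × X) // q.2 0 = diag X q.1}, C(I, X)) :=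
    invConcat.comp ⟨fun q => ⟨(ω (q.1.2 1).1, M q), hL q⟩,
      ((ω.continuous.comp (continuous_fst.comp ((ContinuousEvalConst.continuous_eval_const 1).comp
        (continuous_snd.comp continuous_subtype_val)))).prodMk M.continuous).subtype_mk _⟩
  obtain ⟨l, hl, hlΔ⟩ := exists_strict_lift (f' := pathFib X) L (fun q => Prod.ext
    ((invConcat_zero _).trans (hω1 _)) ((invConcat_one _).trans (congrArg Prod.snd (hM q))))
    n (X × X) s1 G hG0
  obtain ⟨h, h0, h1, h2⟩ := exists_contract_invConcat ω
  refine exists_strict_section hX l (fun z => (hl z).trans (hG1 z)) h (fun x => ?_) (fun x => ?_)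
    fun q => Prod.ext ((h2 q).1.trans (hω1 _)) ((h2 q).2.trans (hω1 _))
  · obtain ⟨h', e⟩ := hlΔ (x, x) x (DFunLike.congr_fun hs1Δ x)
    refine e.trans (congrArg _ ?_)
    rw [h0]
    refine congrArg invConcat (Subtype.ext (Prod.ext ?_ rfl))
    exact congrArg ω (congrArg Prod.fst (hG1 (x, x)))
  · rw [h1, hω1]
    rfl

theorem TC_eq_TCM (hX : LocallyEquiconnected X) (h : secat (diag X) = relcat (diag X)) :
    TC X = TCM X :=
  le_antisymm (TC_le_TCM X) ((TCM_le_relcat_diag hX).trans (h ▸ secat_diag_le_TC X))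

end Comparison

end SecCat

theorem mainTheorem2 :
    (SecCat.DEHConjecture.{u} → SecCat.ISConjecture.{u}) ∧
    ∀ (X : Type u) [TopologicalSpace X], SecCat.LocallyEquiconnected X →
      SecCat.HasHomotopyRetraction (SecCat.diag X) ∧
        (SecCat.secat (SecCat.diag X) = SecCat.relcat (SecCat.diag X) →
          SecCat.TC X = SecCat.TCM X) :=
  ⟨fun hD _ _ hK => SecCat.TC_eq_TCM (SecCat.locallyEquiconnected_realization hK)
    (hD _ _ _ (SecCat.hasHomotopyRetraction_diag _)),
  fun X _ hX => ⟨SecCat.hasHomotopyRetraction_diag X, SecCat.TC_eq_TCM hX⟩⟩
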